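/- Let $G:[0,\infty)\to[0,\infty)$ be a Young function, i.e. $G$ is continuous, nonnegative, strictly increasing and convex with $G(t)=\int_0^t g(r)\,dr$, and suppose that it satisfies the growth condition $$1<p^-\le \frac{t\,g(t)}{G(t)}\le p^+<\infty\qquad\text{for all } t>0. \tag{L}$$ Let $s\in(0,1)$ be such that $sp^->1$. For measurable $u:\mathbb R_+\to\mathbb R$ put $$\Phi_G(u)=\int_0^\infty G(|u(x)|)\,dx,\qquad \Phi_{s,G}(u)=\int_0^\infty\!\!\int_0^\infty G\Big(\frac{|u(x)-u(y)|}{|x-y|^s}\Big)\frac{dx\,dy}{|x-y|},$$ $$\|u\|_G=\inf\{\lambda>0:\Phi_G(u/\lambda)\le 1\},\qquad [u]_{s,G}=\inf\{\lambda>0:\Phi_{s,G}(u/\lambda)\le 1\},$$ and let $W^{s,G}(\mathbb R_+)$ be the set of measurable $u$ with $\Phi_G(u)<\infty$ and $\Phi_{s,G}(u)<\infty$. Let $\psi_G(x)=x^{p^+}$ if $x\ge1$ and $\psi_G(x)=x^{p^-}$ if $x<1$, let $\phi_G(x)=x^{1/p^-}$ if $x\ge1$ and $\phi_G(x)=x^{1/p^+}$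 if $x<1$, and set $$C_H=2^{p^+}\Big(1+\psi_G\Big(\frac{p^-}{sp^--1}\Big)\Big).$$ Then every $u\in W^{s,G}(\mathbb R_+)$ agrees almost everywhere on $(0,\infty)$ with a function that is Hölder continuous with exponent $s-1/p^-$ on $[0,\delta)$ for some $\delta>0$. Consequently $u(0)$, the value at $0$ of a representative of $u$ that is continuous on some $[0,\delta)$, $\delta>0$, exists and does not depend on the representative. If $u(0)=0$, then $$\int_0^\infty G\Big(\frac{|u(x)|}{x^s}\Big)\,dx\le C_H\,\Phi_{s,G}(u)\qquad\text{and}\qquad \Big\|\frac{u}{x^s}\Big\|_G\le \phi_G(C_H)\,[u]_{s,G}.$$ -/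

import Mathlib

open MeasureTheory Set
open scoped ENNReal

noncomputable section

namespace OrliczHardy

/-- `G` is a Young function with density `g`: on `[0, ∞)` it is continuous, nonnegative, strictly
increasing and convex, and `G t = ∫₀ᵗ g`. Only the values of `G` and `g` on `[0, ∞)` matter.
The density is the derivative of `G` wherever `g` is continuous, and almost everywhere. -/
structure IsYoungFunction (G g : ℝ → ℝ) : Prop where
  continuousOn : ContinuousOn G (Ici 0)
  nonneg : ∀ t, 0 ≤ t → 0 ≤ G t
  strictMonoOn : StrictMonoOn G (Ici 0)
  convexOn : ConvexOn ℝ (Ici 0) G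
  intervalIntegrable : ∀ t, 0 ≤ t → IntervalIntegrable g volume 0 t
  eq_integral : ∀ t, 0 ≤ t → G t = ∫ r in (0 : ℝ)..t, g r

/-- The growth condition (L): `1 < p⁻ ≤ t g(t) / G(t) ≤ p⁺ < ∞` for all `t > 0`. -/
def GrowthCondition (G g : ℝ → ℝ) (pm pp : ℝ) : Prop :=
  1 < pm ∧ ∀ t, 0 < t → pm ≤ t * g t / G t ∧ t * g t / G t ≤ pp

/-- The modular `∫₀^∞ G(|u(x)|) dx`, with values in `[0, ∞]`. -/
def modular (G : ℝ → ℝ) (u : ℝ → ℝ) : ℝ≥0∞ :=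
  ∫⁻ x in Ioi (0 : ℝ), ENNReal.ofReal (G |u x|)

/-- The fractional modular
`∫₀^∞ ∫₀^∞ G(|u(x) - u(y)| / |x - y|^s) dx dy / |x - y|`, with values in `[0, ∞]`. -/
def fracModular (s : ℝ) (G : ℝ → ℝ) (u : ℝ → ℝ) : ℝ≥0∞ :=
  ∫⁻ y in Ioi (0 : ℝ), ∫⁻ x in Ioi (0 : ℝ),
    ENNReal.ofReal (G (|u x - u y| / |x - y| ^ s) / |x - y|)

/-- The Luxemburg functional `inf {l > 0 : Φ(u / l) ≤ 1}` of a modular `Φ`, with values in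
`[0, ∞]` (it is `∞` if there is no such `l`). -/
def luxemburg (Φ : (ℝ → ℝ) → ℝ≥0∞) (u : ℝ → ℝ) : ℝ≥0∞ :=
  ⨅ (l : ℝ) (_ : 0 < l) (_ : Φ (fun x => u x / l) ≤ 1), ENNReal.ofReal l

/-- The Luxemburg norm of `L^G(ℝ₊)`. -/
def luxNorm (G : ℝ → ℝ) (u : ℝ → ℝ) : ℝ≥0∞ := luxemburg (modular G) u

/-- The `(s,G)`-Gagliardo seminorm. -/
def gagliardo (s : ℝ) (G : ℝ → ℝ) (u : ℝ → ℝ) : ℝ≥0∞ := luxemburg (fracModular s G) u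

/-- Membership in the fractional Orlicz-Sobolev space `W^{s,G}(ℝ₊)`. A function on `ℝ₊` is
represented by a function on `ℝ` of which only the restriction to `(0, ∞)`, up to null sets,
is used. -/
structure MemW (s : ℝ) (G : ℝ → ℝ) (u : ℝ → ℝ) : Prop where
  aemeasurable : AEMeasurable u (volume.restrict (Ioi 0))
  modular_lt_top : modular G u < ∞
  fracModular_lt_top : fracModular s G u < ∞

/-- `u(0) = a`, where `u(0)` is the value at the origin of the representative of `u` that is
continuous in a neighbourhood of the origin in `[0, ∞)`. -/
def HasValueAtZero (u : ℝ → ℝ) (a : ℝ) : Prop :=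
  ∃ v : ℝ → ℝ, v =ᵐ[volume.restrict (Ioi 0)] u ∧
    (∃ δ : ℝ, 0 < δ ∧ ContinuousOn v (Ico 0 δ)) ∧ v 0 = a

/-- `ψ_G(x)`: `x^{p⁺}` if `x ≥ 1` and `x^{p⁻}` if `x < 1`. -/
def psiG (pm pp x : ℝ) : ℝ := if 1 ≤ x then x ^ pp else x ^ pm

/-- `φ_G(x)`: `x^{1/p⁻}` if `x ≥ 1` and `x^{1/p⁺}` if `x < 1`. -/
def phiG (pm pp x : ℝ) : ℝ := if 1 ≤ x then x ^ (1 / pm) else x ^ (1 / pp)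

/-- The constant `C_H = 2^{p⁺} (1 + ψ_G(p⁻ / (s p⁻ - 1)))`. -/
def hardyConst (s pm pp : ℝ) : ℝ := 2 ^ pp * (1 + psiG pm pp (pm / (s * pm - 1)))

end OrliczHardy

end

namespace OrliczHardy

open Filter Topology

/-! Integrating (L) gives `c ^ pm * G t ≤ G (c * t) ≤ c ^ pp * G t` for `c ≥ 1`; everything else is
Jensen's inequality combined with these power bounds. Regularity is a Campanato argument. By Jensen
on a product of two intervals of length comparable to `l` in a common window of length `l`, the
means of `u` over them differ by at most a constant times `l ^ (s - 1 / pm)`. Hence dyadic averages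
converge geometrically, and their limit is a Hölder representative `v`
(`exists_holder_representative`). For Hardy, let `U x` be the mean of `v` over `(0, x)` and write `v
= (v - U) + U`. Jensen bounds the modular of `(v - U) / x ^ s` by the fractional modular with
constant 1. Since `U' = (v - U) / x` and `U` vanishes at the origin, `U x / x ^ s` is the integral
over `t` in `(0, 1)` of `t ^ (s - 1)` times the dilate by `t` of `(v - U) / x ^ s`. Jensen for the
probability measure `κ t ^ (κ - 1) dt`, `κ = s - 1 / pm`, bounds its modular with constant `ψ_G (1 /
κ)`. Adding the two pieces costs `2 ^ pp`, which gives `hardyConst`. The norm inequality follows by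
rescaling. -/

/-! ### Growth of `G` under dilations -/

/-- A function whose growth under small dilations is bounded below infinitesimally is bounded below
under all dilations. -/
theorem mul_exp_le_of_step {F : ℝ → ℝ} {M L : ℝ}
    (hstep : ∀ n : ℕ, 0 < n → ∀ y, 0 < y → F y * (1 + M / n) ≤ F (Real.exp (L / n) * y))
    {y : ℝ} (hy : 0 < y) : F y * Real.exp M ≤ F (Real.exp L * y) := by
  have hlim : Tendsto (fun n : ℕ => F y * (1 + M / n) ^ n) atTop (𝓝 (F y * Real.exp M)) :=
    (Real.tendsto_one_add_div_pow_exp M).const_mul _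
  have hM : Tendsto (fun n : ℕ => 1 + M / (n : ℝ)) atTop (𝓝 (1 + 0)) :=
    (tendsto_const_div_atTop_nhds_zero_nat M).const_add 1
  have hpos : ∀ᶠ n : ℕ in atTop, 0 < 1 + M / (n : ℝ) :=
    hM.eventually (lt_mem_nhds (by norm_num))
  refine le_of_tendsto hlim ?_
  filter_upwards [hpos, eventually_gt_atTop 0] with n hn hn0
  have key : ∀ k : ℕ, F y * (1 + M / n) ^ k ≤ F (Real.exp (L / n) ^ k * y) := by
    intro k
    induction k with
    | zero => simp
    | succ k ih =>
      calc F y * (1 + M / n) ^ (k + 1) = F y * (1 + M / n) ^ k * (1 + M / n) := by ring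
        _ ≤ F (Real.exp (L / n) ^ k * y) * (1 + M / n) := by gcongr
        _ ≤ F (Real.exp (L / n) * (Real.exp (L / n) ^ k * y)) :=
          hstep n hn0 _ (by positivity)
        _ = F (Real.exp (L / n) ^ (k + 1) * y) := by ring_nf
  have hnn : (n : ℝ) ≠ 0 := by positivity
  have h := key n
  rwa [← Real.exp_nat_mul, mul_div_cancel₀ _ hnn] at h

variable {G g : ℝ → ℝ} {pm pp s : ℝ}

namespace IsYoungFunction

theorem map_zero (hG : IsYoungFunction G g) : G 0 = 0 := by
  simpa using hG.eq_integral 0 le_rfl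

theorem mono (hG : IsYoungFunction G g) {a b : ℝ} (ha : 0 ≤ a) (hab : a ≤ b) : G a ≤ G b :=
  hG.strictMonoOn.monotoneOn ha (ha.trans hab) hab

theorem pos (hG : IsYoungFunction G g) {a : ℝ} (ha : 0 < a) : 0 < G a := by
  simpa [hG.map_zero] using hG.strictMonoOn (mem_Ici.2 le_rfl) ha.le ha

theorem continuous_comp (hG : IsYoungFunction G g) {X : Type*} [TopologicalSpace X] {f : X → ℝ}
    (hf : Continuous f) (h0 : ∀ x, 0 ≤ f x) : Continuous fun x => G (f x) :=
  hG.continuousOn.comp_continuous hf h0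

theorem measurable_comp (hG : IsYoungFunction G g) {X : Type*} [MeasurableSpace X] {f : X → ℝ}
    (hf : Measurable f) (h0 : ∀ x, 0 ≤ f x) : Measurable fun x => G (f x) := by
  have h : Measurable fun t : ℝ => G |t| :=
    (hG.continuous_comp continuous_abs abs_nonneg).measurable
  have h' : (fun x => G (f x)) = (fun t : ℝ => G |t|) ∘ f := by
    funext x
    simp [abs_of_nonneg (h0 x)]
  rw [h']
  exact h.comp hf

theorem sub_eq_integral (hG : IsYoungFunction G g) {x z : ℝ} (hx : 0 ≤ x) (hz : 0 ≤ z) :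
    G z - G x = ∫ r in x..z, g r := by
  rw [hG.eq_integral z hz, hG.eq_integral x hx,
    intervalIntegral.integral_interval_sub_left (hG.intervalIntegrable z hz)
      (hG.intervalIntegrable x hx)]

/-- Since `G` increases, `g r ≥ pm * G r / r ≥ pm * G x / r` on `[x, z]`. Freezing `G` at an
endpoint loses only second order in `log (z / x)`, and iterating small dilations removes the loss.
This way `G` is never differentiated, `g` being its derivative only almost everywhere. -/
theorem mul_log_le_sub (hG : IsYoungFunction G g) (hL : GrowthCondition G g pm pp) {x z : ℝ}
    (hx : 0 < x) (hxz : x ≤ z) : G x * (pm * Real.log (z / x)) ≤ G z - G x := by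
  have hz := hx.trans_le hxz
  rw [hG.sub_eq_integral hx.le hz.le, ← integral_inv_of_pos hx hz, ← mul_assoc,
    ← intervalIntegral.integral_const_mul]
  refine intervalIntegral.integral_mono_on hxz ?_ ?_ fun r hr => ?_
  · exact (intervalIntegral.intervalIntegrable_inv (fun r hr => by
      rw [uIcc_of_le hxz] at hr; exact (hx.trans_le hr.1).ne') continuousOn_id).const_mul _
  · exact (hG.intervalIntegrable x hx.le).symm.trans (hG.intervalIntegrable z hz.le)
  · have hr0 : 0 < r := hx.trans_le hr.1
    have h1 := (hL.2 r hr0).1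
    rw [le_div_iff₀ (hG.pos hr0)] at h1
    have h2 := hG.mono hx.le hr.1
    rw [← div_eq_mul_inv, div_le_iff₀ hr0]
    have : 0 ≤ pm := by linarith [hL.1]
    nlinarith

theorem sub_le_mul_log (hG : IsYoungFunction G g) (hL : GrowthCondition G g pm pp) {x z : ℝ}
    (hx : 0 < x) (hxz : x ≤ z) : G z - G x ≤ G z * (pp * Real.log (z / x)) := by
  have hz := hx.trans_le hxz
  rw [hG.sub_eq_integral hx.le hz.le, ← integral_inv_of_pos hx hz, ← mul_assoc,
    ← intervalIntegral.integral_const_mul]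
  refine intervalIntegral.integral_mono_on hxz ?_ ?_ fun r hr => ?_
  · exact (hG.intervalIntegrable x hx.le).symm.trans (hG.intervalIntegrable z hz.le)
  · exact (intervalIntegral.intervalIntegrable_inv (fun r hr => by
      rw [uIcc_of_le hxz] at hr; exact (hx.trans_le hr.1).ne') continuousOn_id).const_mul _
  · have hr0 : 0 < r := hx.trans_le hr.1
    have h1 := (hL.2 r hr0).2
    have h0 := (hL.2 r hr0).1
    have hpp : 0 ≤ pp := by linarith [hL.1]
    rw [div_le_iff₀ (hG.pos hr0)] at h1
    have h2 := hG.mono hr0.le hr.2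
    rw [← div_eq_mul_inv, le_div_iff₀ hr0]
    nlinarith

end IsYoungFunction

theorem GrowthCondition.le (hL : GrowthCondition G g pm pp) : pm ≤ pp :=
  (hL.2 1 one_pos).1.trans (hL.2 1 one_pos).2

namespace IsYoungFunction

theorem rpow_mul_le (hG : IsYoungFunction G g) (hL : GrowthCondition G g pm pp) {c t : ℝ}
    (hc : 1 ≤ c) (ht : 0 ≤ t) : c ^ pm * G t ≤ G (c * t) := by
  rcases ht.eq_or_lt with rfl | ht
  · simp [hG.map_zero]
  have hc0 : 0 < c := one_pos.trans_le hc
  have hlog := Real.log_nonneg hc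
  have h := mul_exp_le_of_step (F := G) (M := Real.log c * pm) (L := Real.log c)
    (fun n _ y hy => by
      have h1 : y ≤ Real.exp (Real.log c / n) * y :=
        le_mul_of_one_le_left hy.le (Real.one_le_exp (by positivity))
      have h2 := hG.mul_log_le_sub hL hy h1
      rw [mul_div_cancel_right₀ _ hy.ne', Real.log_exp] at h2
      calc G y * (1 + Real.log c * pm / n) = G y + G y * (pm * (Real.log c / n)) := by ring
        _ ≤ _ := by linarith) ht
  rw [Real.exp_log hc0, ← Real.rpow_def_of_pos hc0] at h
  linarith

theorem map_mul_le_rpow_of_one_le (hG : IsYoungFunction G g) (hL : GrowthCondition G g pm pp)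
    {c t : ℝ} (hc : 1 ≤ c) (ht : 0 ≤ t) : G (c * t) ≤ c ^ pp * G t := by
  rcases ht.eq_or_lt with rfl | ht
  · simp [hG.map_zero]
  have hc0 : 0 < c := one_pos.trans_le hc
  have hlog := Real.log_nonneg hc
  -- The upper bound comes from going down from `c * t` to `t`, hence the negative `M` and `L`.
  have h := mul_exp_le_of_step (F := G) (M := -(Real.log c * pp)) (L := -Real.log c)
    (fun n _ y hy => by
      have h1 : Real.exp (-Real.log c / n) * y ≤ y :=
        mul_le_of_le_one_left hy.le (Real.exp_le_one_iff.2
          (div_nonpos_of_nonpos_of_nonneg (by linarith) (by positivity)))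
      have h2 := hG.sub_le_mul_log hL (by positivity) h1
      have h3 : y / (Real.exp (-Real.log c / n) * y) = Real.exp (Real.log c / n) := by
        rw [neg_div, Real.exp_neg]
        field_simp
      rw [h3, Real.log_exp] at h2
      calc G y * (1 + -(Real.log c * pp) / n) = G y - G y * (pp * (Real.log c / n)) := by ring
        _ ≤ _ := by linarith) (mul_pos hc0 ht)
  rw [Real.exp_neg, Real.exp_neg, Real.exp_log hc0, ← Real.rpow_def_of_pos hc0,
    inv_mul_cancel_left₀ hc0.ne', ← div_eq_mul_inv, div_le_iff₀ (by positivity)] at h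
  linarith

theorem map_mul_le_rpow_of_le_one (hG : IsYoungFunction G g) (hL : GrowthCondition G g pm pp)
    {c t : ℝ} (hc0 : 0 < c) (hc : c ≤ 1) (ht : 0 ≤ t) : G (c * t) ≤ c ^ pm * G t := by
  have h := hG.rpow_mul_le hL ((one_le_inv₀ hc0).2 hc) (mul_nonneg hc0.le ht)
  rw [inv_mul_cancel_left₀ hc0.ne', Real.inv_rpow hc0.le, inv_mul_le_iff₀ (by positivity)] at h
  exact h

theorem map_mul_le_psiG (hG : IsYoungFunction G g) (hL : GrowthCondition G g pm pp) {c t : ℝ}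
    (hc : 0 < c) (ht : 0 ≤ t) : G (c * t) ≤ psiG pm pp c * G t := by
  unfold psiG
  split_ifs with h
  · exact hG.map_mul_le_rpow_of_one_le hL h ht
  · exact hG.map_mul_le_rpow_of_le_one hL hc (not_le.1 h).le ht

/-- Source of the factor `2 ^ pp` in `hardyConst`. -/
theorem map_add_le (hG : IsYoungFunction G g) (hL : GrowthCondition G g pm pp) {a b : ℝ}
    (ha : 0 ≤ a) (hb : 0 ≤ b) : G (a + b) ≤ 2 ^ pp * (G a + G b) := by
  have h1 : G (a + b) ≤ G (2 * max a b) :=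
    hG.mono (by positivity) (by linarith [le_max_left a b, le_max_right a b])
  refine h1.trans ((hG.map_mul_le_rpow_of_one_le hL one_le_two (ha.trans (le_max_left a b))).trans ?_)
  gcongr
  rcases max_choice a b with h | h <;> rw [h] <;> linarith [hG.nonneg a ha, hG.nonneg b hb]

theorem rpow_mul_map_one_le (hG : IsYoungFunction G g) (hL : GrowthCondition G g pm pp) {t : ℝ}
    (ht : 1 ≤ t) : t ^ pm * G 1 ≤ G t := by
  simpa using hG.rpow_mul_le hL ht zero_le_one

/-- Makes functions of finite modular locally integrable, so that their averages make sense. -/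
theorem le_one_add_div (hG : IsYoungFunction G g) (hL : GrowthCondition G g pm pp) {t : ℝ}
    (ht : 0 ≤ t) : t ≤ 1 + G t / G 1 := by
  have h1 := hG.pos one_pos
  rcases le_total t 1 with h | h
  · have := div_nonneg (hG.nonneg t ht) h1.le
    linarith
  · have h2 := hG.rpow_mul_map_one_le hL h
    have h3 : t ^ (1 : ℝ) ≤ t ^ pm := Real.rpow_le_rpow_of_exponent_le h hL.1.le
    rw [← le_div_iff₀ h1] at h2
    rw [Real.rpow_one] at h3
    linarith

/-! ### Jensen's inequality and the kernel -/

/-- Jensen's inequality with values in `[0, ∞]`. No integrability is needed: if `f` is not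
integrable then neither is `G ∘ f`. -/
theorem map_integral_le_lintegral (hG : IsYoungFunction G g) {X : Type*} [MeasurableSpace X]
    {μ : Measure X} [IsProbabilityMeasure μ] {f : X → ℝ} (hf : Measurable f) (h0 : ∀ x, 0 ≤ f x) :
    ENNReal.ofReal (G (∫ x, f x ∂μ)) ≤ ∫⁻ x, ENNReal.ofReal (G (f x)) ∂μ := by
  by_cases hfi : Integrable f μ
  swap
  · simp [integral_undef hfi, hG.map_zero]
  have hGm := hG.measurable_comp hf h0
  by_cases hfin : ∫⁻ x, ENNReal.ofReal (G (f x)) ∂μ = ∞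
  · simp [hfin]
  have hGi : Integrable (fun x => G (f x)) μ :=
    (lintegral_ofReal_ne_top_iff_integrable hGm.aestronglyMeasurable
      (ae_of_all _ fun x => hG.nonneg _ (h0 x))).1 hfin
  rw [← ofReal_integral_eq_lintegral_ofReal hGi (ae_of_all _ fun x => hG.nonneg _ (h0 x))]
  exact ENNReal.ofReal_le_ofReal (hG.convexOn.map_integral_le hG.continuousOn isClosed_Ici
    (ae_of_all _ h0) hfi hGi)

/-- Comparison of the difference quotient at scale `l` with the kernel of the fractional
modular. -/
theorem map_div_le_kernel (hG : IsYoungFunction G g) (hs : 0 < s) {x y l a : ℝ} (ha : x = y → a = 0)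
    (h : |x - y| ≤ l) :
    ENNReal.ofReal (G (|a| / l ^ s))
      ≤ ENNReal.ofReal l * ENNReal.ofReal (G (|a| / |x - y| ^ s) / |x - y|) := by
  have hl : 0 ≤ l := (abs_nonneg _).trans h
  rcases eq_or_ne x y with hxy | hxy
  -- On the diagonal the kernel is 0 by division by zero, so the left side must vanish as well.
  · simp [ha hxy, hG.map_zero]
  have hd : 0 < |x - y| := abs_pos.2 (sub_ne_zero.2 hxy)
  rw [← ENNReal.ofReal_mul hl]
  refine ENNReal.ofReal_le_ofReal ?_
  have h1 : G (|a| / l ^ s) ≤ G (|a| / |x - y| ^ s) :=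
    hG.mono (by positivity) (by gcongr)
  have h2 : 0 ≤ G (|a| / |x - y| ^ s) := hG.nonneg _ (by positivity)
  have h3 : 1 ≤ l / |x - y| := (one_le_div hd).2 h
  calc _ ≤ 1 * G (|a| / |x - y| ^ s) := by linarith
    _ ≤ l / |x - y| * G (|a| / |x - y| ^ s) := by gcongr
    _ = _ := by ring

end IsYoungFunction

theorem modular_congr {u v : ℝ → ℝ} (h : u =ᵐ[volume.restrict (Ioi 0)] v) :
    modular G u = modular G v :=
  lintegral_congr_ae (h.mono fun x hx => by simp only [hx])

theorem fracModular_congr {u v : ℝ → ℝ} (h : u =ᵐ[volume.restrict (Ioi 0)] v) :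
    fracModular s G u = fracModular s G v :=
  lintegral_congr_ae (h.mono fun y hy =>
    lintegral_congr_ae (h.mono fun x hx => by simp only [hx, hy]))

theorem MemW.congr {u v : ℝ → ℝ} (hu : MemW s G u) (h : u =ᵐ[volume.restrict (Ioi 0)] v) :
    MemW s G v :=
  ⟨hu.aemeasurable.congr h, modular_congr h ▸ hu.modular_lt_top,
    fracModular_congr h ▸ hu.fracModular_lt_top⟩

/-! ### Hölder continuity from averages -/

namespace IsYoungFunction

theorem locallyIntegrable_indicator (hG : IsYoungFunction G g) (hL : GrowthCondition G g pm pp)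
    {u : ℝ → ℝ} (hm : Measurable u) (hu : modular G u < ∞) :
    LocallyIntegrable ((Ioi (0 : ℝ)).indicator u) volume := by
  have hGi : IntegrableOn (fun x => G |u x|) (Ioi 0) :=
    (lintegral_ofReal_ne_top_iff_integrable
      (hG.measurable_comp hm.abs fun x => abs_nonneg _).aestronglyMeasurable
      (ae_of_all _ fun x => hG.nonneg _ (abs_nonneg _))).1 hu.ne
  have hGi' : Integrable ((Ioi (0 : ℝ)).indicator fun x => G |u x|) :=
    (integrable_indicator_iff measurableSet_Ioi).2 hGi
  have hdom : LocallyIntegrable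
      (fun x => 1 + (Ioi (0 : ℝ)).indicator (fun x => G |u x|) x / G 1) volume :=
    (locallyIntegrable_const 1).add (hGi'.div_const _).locallyIntegrable
  refine hdom.mono (hm.indicator measurableSet_Ioi).aestronglyMeasurable (ae_of_all _ fun x => ?_)
  refine le_trans ?_ (le_abs_self _)
  by_cases hx : x ∈ Ioi (0 : ℝ)
  · simpa [indicator_of_mem hx] using hG.le_one_add_div hL (abs_nonneg (u x))
  · simp [indicator_of_notMem hx]

/-- The difference of two averages is controlled by the fractional modular. -/
theorem map_integral_cond_sub_le (hG : IsYoungFunction G g) (hs : 0 < s) {u : ℝ → ℝ}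
    (hm : Measurable u) {I J : Set ℝ} (hI : MeasurableSet I) (hJ : MeasurableSet J)
    (hI0 : I ⊆ Ioi 0) (hJ0 : J ⊆ Ioi 0) (hvI : volume I ≠ 0) (hvJ : volume J ≠ 0)
    (hvI' : volume I ≠ ∞) (hvJ' : volume J ≠ ∞)
    (hiI : IntegrableOn u I) (hiJ : IntegrableOn u J) {l : ℝ} (hl : 0 ≤ l)
    (hIJ : ∀ x ∈ I, ∀ y ∈ J, |x - y| ≤ l) :
    ENNReal.ofReal (G (|∫ x, u x ∂(ProbabilityTheory.cond volume I)
        - ∫ y, u y ∂(ProbabilityTheory.cond volume J)| / l ^ s))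
      ≤ (volume I)⁻¹ * ((volume J)⁻¹ * (ENNReal.ofReal l * fracModular s G u)) := by
  have := ProbabilityTheory.cond_isProbabilityMeasure_of_finite hvI hvI'
  have := ProbabilityTheory.cond_isProbabilityMeasure_of_finite hvJ hvJ'
  set μ := ProbabilityTheory.cond volume I with hμ
  set ν := ProbabilityTheory.cond volume J with hν
  have hiμ : Integrable u μ := hiI.smul_measure (ENNReal.inv_ne_top.2 hvI)
  have hiν : Integrable u ν := hiJ.smul_measure (ENNReal.inv_ne_top.2 hvJ)
  -- Written as a single mean over `I × J`, the difference allows one application of Jensen.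
  have hsub : ∫ x, u x ∂μ - ∫ y, u y ∂ν = ∫ z, (u z.1 - u z.2) ∂(μ.prod ν) := by
    rw [integral_sub (hiμ.comp_fst ν) (hiν.comp_snd μ), integral_fun_fst, integral_fun_snd]
    simp
  have hls : 0 ≤ l ^ s := by positivity
  have hmono : |∫ x, u x ∂μ - ∫ y, u y ∂ν| / l ^ s
      ≤ ∫ z, |u z.1 - u z.2| / l ^ s ∂(μ.prod ν) := by
    rw [hsub, integral_div]
    gcongr
    exact abs_integral_le_integral_abs
  have hmeas : Measurable fun z : ℝ × ℝ => |u z.1 - u z.2| / l ^ s :=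
    ((hm.comp measurable_fst).sub (hm.comp measurable_snd)).abs.div_const _
  refine (ENNReal.ofReal_le_ofReal (hG.mono (by positivity) hmono)).trans ?_
  refine (hG.map_integral_le_lintegral hmeas fun z => by positivity).trans ?_
  have hmeas' : Measurable fun z : ℝ × ℝ => ENNReal.ofReal (G (|u z.1 - u z.2| / l ^ s)) :=
    (hG.measurable_comp hmeas fun z => by positivity).ennreal_ofReal
  rw [lintegral_prod_symm' _ hmeas']
  simp only [hμ, hν, ProbabilityTheory.cond, lintegral_smul_measure, smul_eq_mul]
  rw [lintegral_const_mul' _ _ (ENNReal.inv_ne_top.2 hvI), ← mul_assoc, ← mul_assoc,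
    mul_comm (volume J)⁻¹]
  gcongr
  calc ∫⁻ y in J, ∫⁻ x in I, ENNReal.ofReal (G (|u x - u y| / l ^ s))
      ≤ ∫⁻ y in J, ∫⁻ x in I, ENNReal.ofReal l *
          ENNReal.ofReal (G (|u x - u y| / |x - y| ^ s) / |x - y|) := by
        refine setLIntegral_mono' hJ fun y hy => setLIntegral_mono' hI fun x hx => ?_
        exact hG.map_div_le_kernel hs (fun h => by simp [h]) (hIJ x hx y hy)
    _ = ENNReal.ofReal l * ∫⁻ y in J, ∫⁻ x in I,
          ENNReal.ofReal (G (|u x - u y| / |x - y| ^ s) / |x - y|) := by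
        simp_rw [lintegral_const_mul' _ _ ENNReal.ofReal_ne_top]
    _ ≤ _ := by
        gcongr
        exact (lintegral_mono fun y => lintegral_mono_set hI0).trans (lintegral_mono_set hJ0)

end IsYoungFunction

/-- The average of `u` over the interval of length `h` to the right of `x`. -/
noncomputable def rightAverage (u : ℝ → ℝ) (x h : ℝ) : ℝ := h⁻¹ * ∫ t in x..(x + h), u t

theorem integral_cond_Ioc (u : ℝ → ℝ) (x : ℝ) {h : ℝ} (hh : 0 ≤ h) :
    ∫ t, u t ∂(ProbabilityTheory.cond volume (Ioc x (x + h))) = rightAverage u x h := by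
  rw [ProbabilityTheory.cond, integral_smul_measure, rightAverage,
    intervalIntegral.integral_of_le (by linarith)]
  simp [hh]

namespace IsYoungFunction

/-- Both intervals lie in `[x, x + l]` and have length at least `l / 2`, so `T`, the difference
divided by `l ^ s`, satisfies `G T ≤ 4 * P / l`. The lower power bound on `G` then gives `T` at most
a multiple of `l ^ (-(1 / pm))`. -/
theorem abs_rightAverage_sub_le (hG : IsYoungFunction G g) (hL : GrowthCondition G g pm pp)
    (hs : 0 < s) {u : ℝ → ℝ} (hm : Measurable u) (hloc : LocallyIntegrable u volume)
    (hfin : fracModular s G u < ∞) {x y h k l : ℝ} (hx : 0 ≤ x) (hxy : x ≤ y) (hl1 : l ≤ 1)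
    (hl0 : 0 < l) (hh : l / 2 ≤ h) (hk : l / 2 ≤ k) (hhl : h ≤ l) (hkl : y + k ≤ x + l) :
    |rightAverage u x h - rightAverage u y k|
      ≤ (1 + (4 * (fracModular s G u).toReal / G 1) ^ (1 / pm)) * l ^ (s - 1 / pm) := by
  have hh0 : 0 < h := by linarith
  have hk0 : 0 < k := by linarith
  have hpm : 0 < pm := by linarith [hL.1]
  have hG1 := hG.pos one_pos
  have hint : ∀ a b : ℝ, IntegrableOn u (Ioc a b) := fun a b =>
    (hloc.integrableOn_isCompact isCompact_Icc).mono_set Ioc_subset_Icc_self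
  have hkey := hG.map_integral_cond_sub_le hs hm (I := Ioc x (x + h)) (J := Ioc y (y + k))
    measurableSet_Ioc measurableSet_Ioc (fun t ht => hx.trans_lt ht.1)
    (fun t ht => (hx.trans hxy).trans_lt ht.1) (by simpa using hh0) (by simpa using hk0)
    (by simp) (by simp) (hint _ _) (hint _ _) hl0.le
    (fun a ha b hb => abs_le.2 ⟨by linarith [ha.1, hb.2], by linarith [ha.2, hb.1]⟩)
  rw [integral_cond_Ioc _ _ hh0.le, integral_cond_Ioc _ _ hk0.le] at hkey
  set P := (fracModular s G u).toReal with hP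
  have hP0 : 0 ≤ P := ENNReal.toReal_nonneg
  rw [← ENNReal.ofReal_toReal hfin.ne, Real.volume_Ioc, Real.volume_Ioc, add_sub_cancel_left,
    add_sub_cancel_left, ← ENNReal.ofReal_inv_of_pos hh0, ← ENNReal.ofReal_inv_of_pos hk0,
    ← ENNReal.ofReal_mul hl0.le, ← ENNReal.ofReal_mul (by positivity),
    ← ENNReal.ofReal_mul (by positivity), ENNReal.ofReal_le_ofReal_iff (by positivity)] at hkey
  set T := |rightAverage u x h - rightAverage u y k| / l ^ s with hT
  have hT0 : 0 ≤ T := by positivity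
  have hGT : G T ≤ 4 * P / l := by
    refine hkey.trans ?_
    calc h⁻¹ * (k⁻¹ * (l * P)) ≤ (l / 2)⁻¹ * ((l / 2)⁻¹ * (l * P)) := by gcongr
      _ = 4 * P / l := by field_simp; ring
  have hTle : T ≤ (1 + (4 * P / G 1) ^ (1 / pm)) * l ^ (-(1 / pm)) := by
    have hB : 0 ≤ (4 * P / G 1) ^ (1 / pm) := by positivity
    have hl2 : 1 ≤ l ^ (-(1 / pm)) :=
      Real.one_le_rpow_of_pos_of_le_one_of_nonpos hl0 hl1 (by
        have : 0 < 1 / pm := by positivity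
        linarith)
    -- The power bound from below is available only for `T ≥ 1`. Otherwise the summand 1 suffices,
    -- because `l ≤ 1`.
    rcases le_total T 1 with h1 | h1
    · nlinarith
    · have h2 := (hG.rpow_mul_map_one_le hL h1).trans hGT
      rw [← le_div_iff₀ hG1] at h2
      have h3 : T ≤ (4 * P / l / G 1) ^ (1 / pm) := by
        calc T = (T ^ pm) ^ (1 / pm) := by
              rw [← Real.rpow_mul hT0, mul_one_div_cancel hpm.ne', Real.rpow_one]
          _ ≤ _ := by gcongr
      have h4 : 4 * P / l / G 1 = 4 * P / G 1 * l⁻¹ := by ring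
      rw [h4, Real.mul_rpow (by positivity) (by positivity), Real.inv_rpow hl0.le,
        ← Real.rpow_neg hl0.le] at h3
      nlinarith
  have hls : 0 < l ^ s := by positivity
  rw [hT, div_le_iff₀ hls, mul_assoc, ← Real.rpow_add hl0] at hTle
  rwa [sub_eq_neg_add s]

end IsYoungFunction

theorem continuous_of_holder {v : ℝ → ℝ} {C α δ : ℝ} (hα : 0 < α) (hδ : 0 < δ)
    (h : ∀ x y, |x - y| ≤ δ → |v x - v y| ≤ C * |x - y| ^ α) : Continuous v := by
  refine continuous_iff_continuousAt.2 fun x => ?_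
  rw [ContinuousAt, tendsto_iff_dist_tendsto_zero]
  have hlim : Tendsto (fun y => C * |y - x| ^ α) (𝓝 x) (𝓝 0) := by
    have : Continuous fun y : ℝ => C * |y - x| ^ α :=
      continuous_const.mul ((continuous_id.sub continuous_const).abs.rpow_const
        fun _ => Or.inr hα.le)
    simpa [Real.zero_rpow hα.ne'] using this.tendsto x
  refine tendsto_of_tendsto_of_tendsto_of_le_of_le' tendsto_const_nhds hlim
    (Eventually.of_forall fun _ => dist_nonneg) ?_
  filter_upwards [Metric.closedBall_mem_nhds x hδ] with y hy
  exact h y x hy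

namespace IsYoungFunction

theorem exists_holder_representative (hG : IsYoungFunction G g) (hL : GrowthCondition G g pm pp)
    (hs : 0 < s) (hsp : 1 < s * pm) {u : ℝ → ℝ} (hu : MemW s G u) :
    ∃ v : ℝ → ℝ, ∃ C, Continuous v ∧ v =ᵐ[volume.restrict (Ioi 0)] u ∧
      ∀ x y, |x - y| ≤ 1 / 2 → |v x - v y| ≤ C * |x - y| ^ (s - 1 / pm) := by
  set w₀ := hu.aemeasurable.mk u
  have hw₀ : u =ᵐ[volume.restrict (Ioi 0)] w₀ := hu.aemeasurable.ae_eq_mk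
  have hm₀ : Measurable w₀ := hu.aemeasurable.measurable_mk
  set w := (Ioi (0 : ℝ)).indicator w₀
  have hw : u =ᵐ[volume.restrict (Ioi 0)] w :=
    hw₀.trans (indicator_ae_eq_restrict measurableSet_Ioi).symm
  have hm : Measurable w := hm₀.indicator measurableSet_Ioi
  have hloc : LocallyIntegrable w volume :=
    hG.locallyIntegrable_indicator hL hm₀ (hu.congr hw₀).modular_lt_top
  have hfin : fracModular s G w < ∞ := (hu.congr hw).fracModular_lt_top
  have hpm : 0 < pm := by linarith [hL.1]
  have hα : 0 < s - 1 / pm := by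
    rw [sub_pos, div_lt_iff₀ hpm]
    exact hsp
  set α := s - 1 / pm with hα_def
  obtain ⟨K, hK0, hK⟩ : ∃ K : ℝ, 0 ≤ K ∧ ∀ x y h k l : ℝ, 0 ≤ x → x ≤ y → l ≤ 1 → 0 < l →
      l / 2 ≤ h → l / 2 ≤ k → h ≤ l → y + k ≤ x + l →
      |rightAverage w x h - rightAverage w y k| ≤ K * l ^ α := by
    refine ⟨1 + (4 * (fracModular s G w).toReal / G 1) ^ (1 / pm), ?_, ?_⟩
    · have := hG.pos one_pos
      positivity
    · intro x y h k l h1 h2 h3 h4 h5 h6 h7 h8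
      exact hG.abs_rightAverage_sub_le hL hs hm hloc hfin h1 h2 h3 h4 h5 h6 h7 h8
  set ρ : ℝ := (1 / 2) ^ α with hρ
  have hρ0 : 0 ≤ ρ := by positivity
  have hρ1 : ρ < 1 := Real.rpow_lt_one (by norm_num) (by norm_num) hα
  have hρn : ∀ n : ℕ, ((1 / 2 : ℝ) ^ n) ^ α = ρ ^ n := fun n => by
    rw [hρ, ← Real.rpow_natCast, ← Real.rpow_natCast, ← Real.rpow_mul (by norm_num),
      ← Real.rpow_mul (by norm_num), mul_comm]
  have hstep : ∀ x, 0 ≤ x → ∀ n : ℕ,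
      dist (rightAverage w x ((1 / 2) ^ n)) (rightAverage w x ((1 / 2) ^ (n + 1)))
        ≤ K * ρ ^ n := by
    intro x hx n
    have hn : (0 : ℝ) < (1 / 2) ^ n := by positivity
    rw [Real.dist_eq, ← hρn]
    refine hK x x _ _ _ hx le_rfl (pow_le_one₀ (by norm_num) (by norm_num)) hn (by linarith) ?_
      le_rfl ?_ <;> rw [pow_succ] <;> linarith
  have hlim : ∀ x, ∃ a, 0 ≤ x →
      Tendsto (fun n : ℕ => rightAverage w x ((1 / 2) ^ n)) atTop (𝓝 a) := by
    intro x
    by_cases hx : 0 ≤ x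
    · obtain ⟨a, ha⟩ := cauchySeq_tendsto_of_complete (cauchySeq_of_le_geometric ρ K hρ1 (hstep x hx))
      exact ⟨a, fun _ => ha⟩
    · exact ⟨0, fun h => absurd h hx⟩
  choose v hv using hlim
  have hdist : ∀ x, 0 ≤ x → ∀ n : ℕ,
      dist (rightAverage w x ((1 / 2) ^ n)) (v x) ≤ K * ρ ^ n / (1 - ρ) := fun x hx =>
    dist_le_of_le_geometric_of_tendsto ρ K hρ1 (hstep x hx) (hv x hx)
  have hρ2 : 0 < 1 - ρ := by linarith
  set C := K * (1 + 2 * ρ / (1 - ρ)) * 4 ^ α with hC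
  have hC0 : 0 ≤ C := by positivity
  have hlt : ∀ x y, 0 ≤ x → x < y → y - x ≤ 1 / 2 → |v x - v y| ≤ C * (y - x) ^ α := by
    intro x y hx hxy hd
    -- The scale satisfies `2 * (y - x) ≤ 2⁻ⁿ < 4 * (y - x)`. The first bound puts the intervals of
    -- length `2⁻ⁿ / 2` starting at `x` and `y` in a window of length `2⁻ⁿ`; the second produces the
    -- factor `4 ^ α`.
    obtain ⟨n, hn1, hn2⟩ := exists_nat_pow_near_of_lt_one (x := 2 * (y - x)) (y := (1 / 2 : ℝ))
      (by linarith) (by linarith) (by norm_num) (by norm_num)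
    have hn : (0 : ℝ) < (1 / 2) ^ n := by positivity
    have hsucc : (1 / 2 : ℝ) ^ (n + 1) = (1 / 2) ^ n / 2 := by rw [pow_succ]; ring
    have h1 := hK x y ((1 / 2) ^ (n + 1)) ((1 / 2) ^ (n + 1)) ((1 / 2) ^ n) hx hxy.le
      (pow_le_one₀ (by norm_num) (by norm_num)) hn hsucc.ge hsucc.ge (by linarith) (by linarith)
    rw [hρn] at h1
    have h2 := hdist x hx (n + 1)
    have h3 := hdist y (hx.trans hxy.le) (n + 1)
    rw [dist_comm, Real.dist_eq] at h2
    rw [Real.dist_eq] at h3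
    have h4 : |v x - v y| ≤ K * ρ ^ n + 2 * (K * ρ ^ (n + 1) / (1 - ρ)) := by
      rw [abs_le] at h1 h2 h3 ⊢
      constructor <;> linarith [h1.1, h1.2, h2.1, h2.2, h3.1, h3.2]
    have h5 : ρ ^ n ≤ 4 ^ α * (y - x) ^ α := by
      rw [← hρn, ← Real.mul_rpow (by norm_num) (by linarith)]
      exact Real.rpow_le_rpow hn.le (by linarith) hα.le
    calc |v x - v y| ≤ K * ρ ^ n + 2 * (K * ρ ^ (n + 1) / (1 - ρ)) := h4
      _ = K * (1 + 2 * ρ / (1 - ρ)) * ρ ^ n := by rw [pow_succ]; ring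
      _ ≤ K * (1 + 2 * ρ / (1 - ρ)) * (4 ^ α * (y - x) ^ α) := by gcongr
      _ = C * (y - x) ^ α := by rw [hC]; ring
  have hhol : ∀ x y, 0 ≤ x → 0 ≤ y → |x - y| ≤ 1 / 2 → |v x - v y| ≤ C * |x - y| ^ α := by
    intro x y hx hy hd
    rcases lt_trichotomy x y with h | h | h
    · rw [abs_sub_comm x y, abs_of_pos (sub_pos.2 h)] at hd ⊢
      exact hlt x y hx h hd
    · simp [h, Real.zero_rpow hα.ne']
    · rw [abs_of_pos (sub_pos.2 h)] at hd ⊢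
      rw [abs_sub_comm]
      exact hlt y x hy h hd
  -- Clamping to `[0, ∞)` is 1-Lipschitz, so the estimate extends to the whole line.
  have hmax : ∀ x y, |x - y| ≤ 1 / 2 →
      |v (max x 0) - v (max y 0)| ≤ C * |x - y| ^ α := by
    intro x y hd
    have h1 := abs_max_sub_max_le_abs x y 0
    exact (hhol _ _ (le_max_right _ _) (le_max_right _ _) (h1.trans hd)).trans (by gcongr)
  refine ⟨fun x => v (max x 0), C, continuous_of_holder hα (by norm_num) hmax, ?_, hmax⟩
  refine EventuallyEq.trans ?_ hw.symm
  refine (ae_restrict_iff' measurableSet_Ioi).2 ?_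
  -- Lebesgue differentiation: the dyadic averages are right difference quotients of the primitive
  -- of `w`.
  filter_upwards [_root_.LocallyIntegrable.ae_hasDerivAt_integral hloc] with x hx hx0
  have hx0' : (0 : ℝ) < x := hx0
  rw [max_eq_left hx0'.le]
  refine tendsto_nhds_unique (hv x hx0'.le) ?_
  have h1 := (hx x).tendsto_slope_zero_right
  have h2 : Tendsto (fun n : ℕ => (1 / 2 : ℝ) ^ n) atTop (𝓝[>] 0) :=
    tendsto_nhdsWithin_iff.2 ⟨tendsto_pow_atTop_nhds_zero_of_lt_one (by norm_num) (by norm_num),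
      Eventually.of_forall fun n => by simp⟩
  simpa [rightAverage, Function.comp_def] using h1.comp h2

end IsYoungFunction

/-! ### The value at the origin -/

theorem HasValueAtZero.unique {u : ℝ → ℝ} {a b : ℝ} (ha : HasValueAtZero u a)
    (hb : HasValueAtZero u b) : a = b := by
  obtain ⟨v, hv, ⟨δ, hδ, hvc⟩, rfl⟩ := ha
  obtain ⟨w, hw, ⟨ε, hε, hwc⟩, rfl⟩ := hb
  have hη : 0 < min δ ε := lt_min hδ hε
  have hae : v =ᵐ[volume.restrict (Ico 0 (min δ ε))] w := by
    rw [restrict_Ico_eq_restrict_Ioc, ← restrict_Ioo_eq_restrict_Ioc]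
    exact ae_restrict_of_ae_restrict_of_subset Ioo_subset_Ioi_self (hv.trans hw.symm)
  exact Measure.eqOn_Ico_of_ae_eq volume hae
    (hvc.mono (Ico_subset_Ico_right (min_le_left _ _)))
    (hwc.mono (Ico_subset_Ico_right (min_le_right _ _))) ⟨le_rfl, hη⟩

/-! ### The average from the origin -/

/-- The average of `v` over `(0, x)`. -/
noncomputable def originAverage (v : ℝ → ℝ) (x : ℝ) : ℝ := (∫ t in (0 : ℝ)..x, v t) / x

theorem continuous_primitive {v : ℝ → ℝ} (hv : Continuous v) :
    Continuous fun x => ∫ t in (0 : ℝ)..x, v t :=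
  intervalIntegral.continuous_primitive (fun a b => hv.intervalIntegrable a b) 0

theorem measurable_originAverage {v : ℝ → ℝ} (hv : Continuous v) :
    Measurable (originAverage v) :=
  (continuous_primitive hv).measurable.div measurable_id

theorem hasDerivAt_originAverage {v : ℝ → ℝ} (hv : Continuous v) {x : ℝ} (hx : x ≠ 0) :
    HasDerivAt (originAverage v) ((v x - originAverage v x) / x) x := by
  have h := (hv.integral_hasStrictDerivAt 0 x).hasDerivAt.div (hasDerivAt_id x) hx
  refine h.congr_deriv ?_
  simp only [originAverage, id]
  field_simp

theorem abs_originAverage_le {v : ℝ → ℝ} {C α δ : ℝ} (hα : 0 ≤ α) (hC : 0 ≤ C)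
    (hle : ∀ x, 0 ≤ x → x ≤ δ → |v x| ≤ C * x ^ α) {x : ℝ} (hx0 : 0 < x) (hx : x ≤ δ) :
    |originAverage v x| ≤ C * x ^ α := by
  have h := intervalIntegral.norm_integral_le_of_norm_le_const (a := 0) (b := x) (f := v)
    (C := C * x ^ α) fun t ht => by
      rw [uIoc_of_le hx0.le] at ht
      refine (hle t ht.1.le (ht.2.trans hx)).trans ?_
      have := ht.1.le
      have := ht.2
      gcongr
  rw [originAverage, abs_div, abs_of_pos hx0, div_le_iff₀ hx0]
  simpa [abs_of_pos hx0] using h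

/-- Near 0 the decay of `v` makes the integrand `O(t ^ (α - 1))`, integrable since `α > 0`; away
from 0 it is continuous. -/
theorem intervalIntegrable_sub_originAverage_div {v : ℝ → ℝ} {C α δ : ℝ} (hv : Continuous v)
    (hα : 0 < α) (hδ : 0 < δ) (hC : 0 ≤ C) (hle : ∀ x, 0 ≤ x → x ≤ δ → |v x| ≤ C * x ^ α)
    {x : ℝ} (hx : 0 < x) :
    IntervalIntegrable (fun t => (v t - originAverage v t) / t) volume 0 x := by
  have hmeas : Measurable fun t => (v t - originAverage v t) / t :=
    (hv.measurable.sub (measurable_originAverage hv)).div measurable_id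
  have h1 : IntervalIntegrable (fun t => (v t - originAverage v t) / t) volume 0 δ := by
    have hdom : IntervalIntegrable (fun t : ℝ => 2 * C * t ^ (α - 1)) volume 0 δ :=
      (intervalIntegral.intervalIntegrable_rpow' (by linarith)).const_mul _
    refine hdom.mono_fun' hmeas.aestronglyMeasurable ?_
    rw [uIoc_of_le hδ.le]
    refine (ae_restrict_iff' measurableSet_Ioc).2 (ae_of_all _ fun t ht => ?_)
    have h2 := hle t ht.1.le ht.2
    have h3 := abs_originAverage_le hα.le hC hle ht.1 ht.2
    simp only
    rw [Real.norm_eq_abs, abs_div, abs_of_pos ht.1, div_le_iff₀ ht.1, mul_assoc,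
      ← Real.rpow_add_one ht.1.ne', sub_add_cancel]
    calc |v t - originAverage v t| ≤ |v t| + |originAverage v t| := abs_sub _ _
      _ ≤ 2 * C * t ^ α := by linarith
  refine h1.trans (ContinuousOn.intervalIntegrable fun t ht => ?_)
  have ht0 : t ≠ 0 := by
    rcases mem_uIcc.1 ht with h | h <;> [exact (hδ.trans_le h.1).ne'; exact (hx.trans_le h.1).ne']
  exact ((hv.continuousAt.sub (hasDerivAt_originAverage hv ht0).continuousAt).div
    continuousAt_id ht0).continuousWithinAt

/-- Fundamental theorem of calculus for the average. The vanishing of `v` at 0, contained in `hle`,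
removes the boundary term. -/
theorem originAverage_eq_integral {v : ℝ → ℝ} {C α δ : ℝ} (hv : Continuous v)
    (hα : 0 < α) (hδ : 0 < δ) (hC : 0 ≤ C) (hle : ∀ x, 0 ≤ x → x ≤ δ → |v x| ≤ C * x ^ α)
    {x : ℝ} (hx : 0 < x) :
    originAverage v x = ∫ t in (0 : ℝ)..x, (v t - originAverage v t) / t := by
  have hlim : Tendsto (originAverage v) (𝓝[>] 0) (𝓝 0) := by
    have h1 : Tendsto (fun t : ℝ => C * t ^ α) (𝓝[>] 0) (𝓝 0) := by
      have : Continuous fun t : ℝ => C * t ^ α :=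
        continuous_const.mul (continuous_id.rpow_const fun _ => Or.inr hα.le)
      simpa [Real.zero_rpow hα.ne'] using (this.tendsto 0).mono_left nhdsWithin_le_nhds
    refine squeeze_zero_norm' ?_ h1
    filter_upwards [Ioc_mem_nhdsGT hδ] with t ht
    exact abs_originAverage_le hα.le hC hle ht.1 ht.2
  rw [intervalIntegral.integral_eq_sub_of_hasDerivAt_of_tendsto hx
    (fun t ht => hasDerivAt_originAverage hv ht.1.ne')
    (intervalIntegrable_sub_originAverage_div hv hα hδ hC hle hx) hlim
    ((hasDerivAt_originAverage hv hx.ne').continuousAt.tendsto.mono_left nhdsWithin_le_nhds),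
    sub_zero]

/-! ### Averages of dilations -/

/-- The probability measure `κ τ^(κ-1) dτ` on `(0, 1]`. -/
noncomputable def powerMeasure (κ : ℝ) : Measure ℝ :=
  (volume.restrict (Ioc 0 1)).withDensity fun t => ENNReal.ofReal (κ * t ^ (κ - 1))

theorem measurable_powerDensity (κ : ℝ) :
    Measurable fun t : ℝ => ENNReal.ofReal (κ * t ^ (κ - 1)) := by
  fun_prop

theorem isProbabilityMeasure_powerMeasure {κ : ℝ} (hκ : 0 < κ) :
    IsProbabilityMeasure (powerMeasure κ) := by
  refine ⟨?_⟩
  have hint : IntegrableOn (fun t : ℝ => κ * t ^ (κ - 1)) (Ioc 0 1) := by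
    have h := (intervalIntegral.intervalIntegrable_rpow' (a := 0) (b := 1)
      (r := κ - 1) (by linarith)).const_mul κ
    rwa [intervalIntegrable_iff_integrableOn_Ioc_of_le zero_le_one] at h
  rw [powerMeasure, withDensity_apply _ MeasurableSet.univ, Measure.restrict_univ,
    ← ofReal_integral_eq_lintegral_ofReal hint ((ae_restrict_iff' measurableSet_Ioc).2
      (ae_of_all _ fun t ht => mul_nonneg hκ.le (Real.rpow_nonneg ht.1.le _))),
    ← intervalIntegral.integral_of_le zero_le_one, intervalIntegral.integral_const_mul,
    integral_rpow (Or.inl (by linarith))]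
  simp [Real.zero_rpow hκ.ne', hκ.ne']

theorem integral_powerMeasure {κ : ℝ} (hκ : 0 < κ) (f : ℝ → ℝ) :
    ∫ t, f t ∂(powerMeasure κ) = ∫ t in (0 : ℝ)..1, κ * t ^ (κ - 1) * f t := by
  rw [powerMeasure, integral_withDensity_eq_integral_toReal_smul (measurable_powerDensity κ)
    (ae_of_all _ fun _ => ENNReal.ofReal_lt_top), intervalIntegral.integral_of_le zero_le_one]
  refine setIntegral_congr_fun measurableSet_Ioc fun t ht => ?_
  simp only [smul_eq_mul]
  rw [ENNReal.toReal_ofReal (mul_nonneg hκ.le (Real.rpow_nonneg ht.1.le _))]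

theorem ae_powerMeasure_mem_Ioc (κ : ℝ) : ∀ᵐ t ∂(powerMeasure κ), t ∈ Ioc (0 : ℝ) 1 :=
  (withDensity_absolutelyContinuous _ _).ae_le (ae_restrict_mem measurableSet_Ioc)

theorem lintegral_comp_mul_right_Ioi (f : ℝ → ℝ≥0∞) {a : ℝ} (ha : 0 < a) :
    ENNReal.ofReal a * ∫⁻ x in Ioi (0 : ℝ), f (x * a) = ∫⁻ x in Ioi (0 : ℝ), f x := by
  have hemb : MeasurableEmbedding fun x : ℝ => x * a :=
    (Homeomorph.mulRight₀ a ha.ne').measurableEmbedding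
  have hpre : (fun x : ℝ => x * a) ⁻¹' Ioi 0 = Ioi 0 := by
    ext x
    simp [ha]
  conv_rhs => rw [← Real.smul_map_volume_mul_right ha.ne', Measure.restrict_smul,
    lintegral_smul_measure, abs_of_pos ha, hemb.restrict_map, hpre, hemb.lintegral_map]
  rfl

namespace IsYoungFunction

/-- A weighted Hardy inequality for modulars: dilations averaged against `τ^(s-1) dτ`. -/
theorem lintegral_map_dilation_average_le (hG : IsYoungFunction G g)
    (hL : GrowthCondition G g pm pp) (hsp : 1 < s * pm) {f : ℝ → ℝ} (hf : Measurable f)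
    (h0 : ∀ x, 0 ≤ f x) :
    ∫⁻ x in Ioi (0 : ℝ), ENNReal.ofReal (G (∫ t in (0 : ℝ)..1, t ^ (s - 1) * f (x * t)))
      ≤ ENNReal.ofReal (psiG pm pp (pm / (s * pm - 1))) *
        ∫⁻ x in Ioi (0 : ℝ), ENNReal.ofReal (G (f x)) := by
  have hpm : 0 < pm := by linarith [hL.1]
  set κ := s - 1 / pm with hκ_def
  have hκ : 0 < κ := by
    rw [hκ_def, sub_pos, div_lt_iff₀ hpm]
    exact hsp
  have hκinv : pm / (s * pm - 1) = κ⁻¹ := by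
    have : s * pm - 1 ≠ 0 := by linarith
    rw [hκ_def, eq_comm, inv_eq_iff_eq_inv, inv_div]
    field_simp
  rw [hκinv]
  have := isProbabilityMeasure_powerMeasure hκ
  have hψ : 0 ≤ psiG pm pp κ⁻¹ := by
    unfold psiG
    split_ifs <;> positivity
  set μ := powerMeasure κ
  -- The absolute value ensures nonnegativity for every `t`, as Jensen requires here; it changes
  -- nothing on `(0, 1]`, which carries `μ`.
  have hjm : Measurable fun z : ℝ × ℝ => |κ⁻¹ * (z.2 ^ (1 / pm) * f (z.1 * z.2))| :=
    (((measurable_snd.pow_const _).mul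
      (hf.comp (measurable_fst.mul measurable_snd))).const_mul _).abs
  have hpt : ∀ x, ENNReal.ofReal (G (∫ t in (0 : ℝ)..1, t ^ (s - 1) * f (x * t)))
      ≤ ∫⁻ t, ENNReal.ofReal (G |κ⁻¹ * (t ^ (1 / pm) * f (x * t))|) ∂μ := by
    intro x
    have heq : ∫ t in (0 : ℝ)..1, t ^ (s - 1) * f (x * t)
        = ∫ t, |κ⁻¹ * (t ^ (1 / pm) * f (x * t))| ∂μ := by
      rw [integral_powerMeasure hκ, intervalIntegral.integral_of_le zero_le_one,
        intervalIntegral.integral_of_le zero_le_one]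
      refine setIntegral_congr_fun measurableSet_Ioc fun t ht => ?_
      have ht0 := ht.1
      have h1 : t ^ (s - 1) = t ^ (κ - 1) * t ^ (1 / pm) := by
        rw [← Real.rpow_add ht0, hκ_def]
        congr 1
        ring
      have h2 : 0 ≤ κ⁻¹ * (t ^ (1 / pm) * f (x * t)) :=
        mul_nonneg (by positivity) (mul_nonneg (by positivity) (h0 _))
      simp only [abs_of_nonneg h2, h1]
      field_simp
    rw [heq]
    exact hG.map_integral_le_lintegral (hjm.comp measurable_prodMk_left) fun t => abs_nonneg _
  have hFm : Measurable fun z : ℝ × ℝ =>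
      ENNReal.ofReal (G |κ⁻¹ * (z.2 ^ (1 / pm) * f (z.1 * z.2))|) :=
    (hG.measurable_comp hjm fun _ => abs_nonneg _).ennreal_ofReal
  calc _ ≤ ∫⁻ x in Ioi (0 : ℝ), ∫⁻ t, ENNReal.ofReal (G |κ⁻¹ * (t ^ (1 / pm) * f (x * t))|) ∂μ :=
        lintegral_mono hpt
    _ = ∫⁻ t, (∫⁻ x in Ioi (0 : ℝ), ENNReal.ofReal (G |κ⁻¹ * (t ^ (1 / pm) * f (x * t))|)) ∂μ :=
        lintegral_lintegral_swap hFm.aemeasurable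
    _ ≤ ∫⁻ _, (ENNReal.ofReal (psiG pm pp κ⁻¹) *
          ∫⁻ x in Ioi (0 : ℝ), ENNReal.ofReal (G (f x))) ∂μ := by
        refine lintegral_mono_ae ?_
        filter_upwards [ae_powerMeasure_mem_Ioc κ] with t ht
        have ht0 := ht.1
        rw [← lintegral_comp_mul_right_Ioi (fun x => ENNReal.ofReal (G (f x))) ht0, ← mul_assoc, ← ENNReal.ofReal_mul hψ,
          ← lintegral_const_mul' _ _ ENNReal.ofReal_ne_top]
        refine lintegral_mono fun x => ?_
        rw [← ENNReal.ofReal_mul (by positivity)]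
        refine ENNReal.ofReal_le_ofReal ?_
        have h2 : 0 ≤ t ^ (1 / pm) * f (x * t) := mul_nonneg (by positivity) (h0 _)
        rw [abs_of_nonneg (mul_nonneg (by positivity) h2)]
        -- Pulling `t ^ (1 / pm)` out of `G` yields exactly `t`, which cancels the Jacobian of the
        -- dilation.
        have h3 := hG.map_mul_le_rpow_of_le_one hL (c := t ^ (1 / pm)) (by positivity)
          (Real.rpow_le_one ht0.le ht.2 (by positivity)) (h0 (x * t))
        rw [← Real.rpow_mul ht0.le, one_div_mul_cancel hpm.ne', Real.rpow_one] at h3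
        calc G (κ⁻¹ * (t ^ (1 / pm) * f (x * t)))
            ≤ psiG pm pp κ⁻¹ * G (t ^ (1 / pm) * f (x * t)) :=
              hG.map_mul_le_psiG hL (by positivity) h2
          _ ≤ psiG pm pp κ⁻¹ * (t * G (f (x * t))) := by gcongr
          _ = _ := by ring
    _ = _ := by simp

/-! ### The modular Hardy inequality -/

/-- The mean oscillation at the origin is controlled by the fractional modular. -/
theorem lintegral_map_sub_originAverage_le (hG : IsYoungFunction G g) (hs : 0 < s) {v : ℝ → ℝ}
    (hv : Continuous v) :
    ∫⁻ x in Ioi (0 : ℝ), ENNReal.ofReal (G (|v x - originAverage v x| / x ^ s))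
      ≤ fracModular s G v := by
  refine setLIntegral_mono' measurableSet_Ioi fun y hy => ?_
  have hy0 : (0 : ℝ) < y := hy
  have hvol : volume (Ioc 0 (0 + y)) ≠ 0 := by simpa using hy0
  have := ProbabilityTheory.cond_isProbabilityMeasure_of_finite hvol (by simp)
  set μ := ProbabilityTheory.cond volume (Ioc 0 (0 + y)) with hμ
  have hint : Integrable v μ :=
    (hv.integrableOn_Icc.mono_set Ioc_subset_Icc_self).smul_measure (ENNReal.inv_ne_top.2 hvol)
  have havg : ∫ x, v x ∂μ = originAverage v y := by
    rw [hμ, integral_cond_Ioc v 0 hy0.le, rightAverage, originAverage, zero_add]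
    ring
  have hle : |v y - originAverage v y| / y ^ s ≤ ∫ x, |v x - v y| / y ^ s ∂μ := by
    have h1 : originAverage v y - v y = ∫ x, (v x - v y) ∂μ := by
      rw [integral_sub hint (integrable_const _), havg]
      simp
    rw [abs_sub_comm, h1, integral_div]
    gcongr
    exact abs_integral_le_integral_abs
  have hmeas : Measurable fun x => |v x - v y| / y ^ s :=
    (hv.measurable.sub_const _).abs.div_const _
  refine (ENNReal.ofReal_le_ofReal (hG.mono (by positivity) hle)).trans ?_
  refine (hG.map_integral_le_lintegral hmeas fun x => by positivity).trans ?_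
  rw [hμ, ProbabilityTheory.cond, lintegral_smul_measure, Real.volume_Ioc, add_sub_cancel_left,
    smul_eq_mul, ENNReal.inv_mul_le_iff (by simpa using hy0) (by simp),
    ← lintegral_const_mul' _ _ ENNReal.ofReal_ne_top, zero_add]
  refine le_trans (setLIntegral_mono' measurableSet_Ioc fun x hx => ?_)
    (lintegral_mono_set Ioc_subset_Ioi_self)
  -- For `x` in `(0, y]` the distance is at most `y`, so the kernel comparison at `l = y` absorbs
  -- the normalisation `1 / y` of the mean.
  refine hG.map_div_le_kernel hs (fun h => by simp [h]) (abs_le.2 ⟨?_, ?_⟩) <;>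
    linarith [hx.1, hx.2]

theorem modular_hardy_of_continuous (hG : IsYoungFunction G g) (hL : GrowthCondition G g pm pp)
    (hs : 0 < s) (hsp : 1 < s * pm) {v : ℝ → ℝ} {C α δ : ℝ} (hv : Continuous v)
    (hα : 0 < α) (hδ : 0 < δ) (hC : 0 ≤ C) (hle : ∀ x, 0 ≤ x → x ≤ δ → |v x| ≤ C * x ^ α) :
    ∫⁻ x in Ioi (0 : ℝ), ENNReal.ofReal (G (|v x| / x ^ s))
      ≤ ENNReal.ofReal (hardyConst s pm pp) * fracModular s G v := by
  set U := originAverage v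
  have hUm : Measurable U := measurable_originAverage hv
  set f : ℝ → ℝ := fun t => |(v t - U t) / t ^ s| with hf
  have hfm : Measurable f :=
    ((hv.measurable.sub hUm).div (measurable_id.pow_const s)).abs
  have hf0 : ∀ t, 0 ≤ f t := fun t => abs_nonneg _
  have hA : ∫⁻ x in Ioi (0 : ℝ), ENNReal.ofReal (G (f x)) ≤ fracModular s G v := by
    refine le_trans (setLIntegral_mono' measurableSet_Ioi fun x hx => ?_)
      (hG.lintegral_map_sub_originAverage_le hs hv)
    have hx0 : (0 : ℝ) < x := hx
    rw [hf]
    simp only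
    rw [abs_div, abs_of_pos (Real.rpow_pos_of_pos hx0 s)]
  have hU : ∀ x, 0 < x → |U x| / x ^ s ≤ ∫ t in (0 : ℝ)..1, t ^ (s - 1) * f (x * t) := by
    intro x hx
    have hxs : 0 < x ^ s := by positivity
    -- Substitution `t ↦ x * t` in the integral formula for `U`.
    have h1 : U x / x ^ s
        = ∫ t in (0 : ℝ)..1, x / x ^ s * ((v (x * t) - U (x * t)) / (x * t)) := by
      rw [intervalIntegral.integral_const_mul,
        intervalIntegral.integral_comp_mul_left (fun t => (v t - U t) / t) hx.ne', mul_zero, mul_one,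
        ← originAverage_eq_integral hv hα hδ hC hle hx, smul_eq_mul]
      field_simp
      rfl
    have h2 : |U x| / x ^ s = |U x / x ^ s| := by rw [abs_div, abs_of_pos hxs]
    rw [h2, h1]
    refine (intervalIntegral.abs_integral_le_integral_abs zero_le_one).trans_eq ?_
    rw [intervalIntegral.integral_of_le zero_le_one, intervalIntegral.integral_of_le zero_le_one]
    refine setIntegral_congr_fun measurableSet_Ioc fun t ht => ?_
    have ht0 := ht.1
    have h3 : x / x ^ s * ((v (x * t) - U (x * t)) / (x * t))
        = t ^ (s - 1) * ((v (x * t) - U (x * t)) / (x * t) ^ s) := by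
      rw [Real.mul_rpow hx.le ht0.le, Real.rpow_sub_one ht0.ne']
      have : 0 < t ^ s := by positivity
      field_simp
    simp only [hf, h3, abs_mul, abs_of_pos (Real.rpow_pos_of_pos ht0 (s - 1))]
  have hB : ∫⁻ x in Ioi (0 : ℝ), ENNReal.ofReal (G (|U x| / x ^ s))
      ≤ ENNReal.ofReal (psiG pm pp (pm / (s * pm - 1))) * fracModular s G v := by
    calc _ ≤ ∫⁻ x in Ioi (0 : ℝ),
          ENNReal.ofReal (G (∫ t in (0 : ℝ)..1, t ^ (s - 1) * f (x * t))) := by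
          refine setLIntegral_mono' measurableSet_Ioi fun x hx => ENNReal.ofReal_le_ofReal ?_
          have hx0 : (0 : ℝ) < x := hx
          exact hG.mono (by positivity) (hU x hx)
      _ ≤ _ := hG.lintegral_map_dilation_average_le hL hsp hfm hf0
      _ ≤ _ := by gcongr
  have hψ : 0 ≤ psiG pm pp (pm / (s * pm - 1)) := by
    have : 0 < pm / (s * pm - 1) := div_pos (by linarith [hL.1]) (by linarith)
    unfold psiG
    split_ifs <;> positivity
  have h2 : (0 : ℝ) ≤ 2 ^ pp := by positivity
  have hGf : Measurable fun x => ENNReal.ofReal (G (f x)) :=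
    (hG.measurable_comp hfm hf0).ennreal_ofReal
  calc ∫⁻ x in Ioi (0 : ℝ), ENNReal.ofReal (G (|v x| / x ^ s))
      ≤ ∫⁻ x in Ioi (0 : ℝ), ENNReal.ofReal (2 ^ pp) *
          (ENNReal.ofReal (G (f x)) + ENNReal.ofReal (G (|U x| / x ^ s))) := by
        refine setLIntegral_mono' measurableSet_Ioi fun x hx => ?_
        have hx0 : (0 : ℝ) < x := hx
        have hxs : 0 < x ^ s := by positivity
        have hU0 : 0 ≤ |U x| / x ^ s := by positivity
        rw [← ENNReal.ofReal_add (hG.nonneg _ (hf0 x)) (hG.nonneg _ hU0),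
          ← ENNReal.ofReal_mul h2]
        refine ENNReal.ofReal_le_ofReal (le_trans (hG.mono (by positivity) ?_)
          (hG.map_add_le hL (hf0 x) hU0))
        rw [hf]
        simp only
        rw [abs_div, abs_of_pos hxs, ← add_div]
        gcongr
        calc |v x| = |(v x - U x) + U x| := by rw [sub_add_cancel]
          _ ≤ _ := abs_add_le _ _
    _ = ENNReal.ofReal (2 ^ pp) * ((∫⁻ x in Ioi (0 : ℝ), ENNReal.ofReal (G (f x)))
          + ∫⁻ x in Ioi (0 : ℝ), ENNReal.ofReal (G (|U x| / x ^ s))) := by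
        rw [lintegral_const_mul' _ _ ENNReal.ofReal_ne_top, lintegral_add_left hGf]
    _ ≤ ENNReal.ofReal (2 ^ pp) * (fracModular s G v +
          ENNReal.ofReal (psiG pm pp (pm / (s * pm - 1))) * fracModular s G v) := by gcongr
    _ = _ := by
        rw [hardyConst, ENNReal.ofReal_mul h2, ENNReal.ofReal_add zero_le_one hψ,
          ENNReal.ofReal_one]
        ring

theorem modular_hardy (hG : IsYoungFunction G g) (hL : GrowthCondition G g pm pp)
    (hs : 0 < s) (hsp : 1 < s * pm) {u : ℝ → ℝ} (hu : MemW s G u) (hu0 : HasValueAtZero u 0) :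
    ∫⁻ x in Ioi (0 : ℝ), ENNReal.ofReal (G (|u x| / x ^ s))
      ≤ ENNReal.ofReal (hardyConst s pm pp) * fracModular s G u := by
  obtain ⟨v, C, hv, hvu, hC⟩ := hG.exists_holder_representative hL hs hsp hu
  have hv0 : v 0 = 0 := HasValueAtZero.unique ⟨v, hvu, ⟨1, one_pos, hv.continuousOn⟩, rfl⟩ hu0
  have hα : 0 < s - 1 / pm := by
    rw [sub_pos, div_lt_iff₀ (by linarith [hL.1])]
    exact hsp
  have h := hG.modular_hardy_of_continuous hL hs hsp (C := |C|) (δ := 1 / 2) hv hα (by norm_num)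
    (abs_nonneg C) fun x hx hx' => by
      have h1 := hC x 0 (by rwa [sub_zero, abs_of_nonneg hx])
      rw [hv0, sub_zero, sub_zero, abs_of_nonneg hx] at h1
      refine h1.trans ?_
      gcongr
      exact le_abs_self C
  rw [fracModular_congr hvu] at h
  refine le_trans (le_of_eq (lintegral_congr_ae (hvu.mono fun x hx => ?_))) h
  simp only [hx]

end IsYoungFunction

/-! ### From the modular to the norm -/

theorem one_le_hardyConst (hL : GrowthCondition G g pm pp) (hsp : 1 < s * pm) :
    1 ≤ hardyConst s pm pp := by
  have hψ : 0 ≤ psiG pm pp (pm / (s * pm - 1)) := by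
    have : 0 < pm / (s * pm - 1) := div_pos (by linarith [hL.1]) (by linarith)
    unfold psiG
    split_ifs <;> positivity
  have h2 : (1 : ℝ) ≤ 2 ^ pp :=
    Real.one_le_rpow one_le_two (by linarith [hL.1, hL.le])
  unfold hardyConst
  nlinarith

theorem HasValueAtZero.div_const {u : ℝ → ℝ} {a : ℝ} (h : HasValueAtZero u a) (l : ℝ) :
    HasValueAtZero (fun x => u x / l) (a / l) := by
  obtain ⟨v, hv, ⟨δ, hδ, hvc⟩, rfl⟩ := h
  exact ⟨fun x => v x / l, hv.mono fun x hx => by simp only [hx],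
    ⟨δ, hδ, hvc.div_const l⟩, rfl⟩

namespace IsYoungFunction

theorem modular_div_const_lt_top (hG : IsYoungFunction G g) (hL : GrowthCondition G g pm pp)
    {u : ℝ → ℝ} (hu : modular G u < ∞) {l : ℝ} (hl : 0 < l) :
    modular G (fun x => u x / l) < ∞ := by
  refine lt_of_le_of_lt ?_ (ENNReal.mul_lt_top (ENNReal.ofReal_lt_top (r := psiG pm pp l⁻¹)) hu)
  have hψ : 0 ≤ psiG pm pp l⁻¹ := by
    unfold psiG
    split_ifs <;> positivity
  rw [modular, modular, ← lintegral_const_mul' _ _ ENNReal.ofReal_ne_top]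
  refine lintegral_mono fun x => ?_
  rw [← ENNReal.ofReal_mul hψ, abs_div, abs_of_pos hl, div_eq_inv_mul]
  exact ENNReal.ofReal_le_ofReal (hG.map_mul_le_psiG hL (by positivity) (abs_nonneg _))

/-- If `l` is admissible for the seminorm of `u`, then `D * l` with `D = C ^ (1 / pm)` is admissible
for `u / x ^ s`: since `D ≥ 1`, shrinking the argument of `G` by `D` gains `D ^ (-pm) = 1 / C`,
which offsets the constant in the modular inequality for `u / l`. -/
theorem luxNorm_hardy (hG : IsYoungFunction G g) (hL : GrowthCondition G g pm pp)
    (hs : 0 < s) (hsp : 1 < s * pm) {u : ℝ → ℝ} (hu : MemW s G u) (hu0 : HasValueAtZero u 0) :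
    luxNorm G (fun x => u x / x ^ s)
      ≤ ENNReal.ofReal (phiG pm pp (hardyConst s pm pp)) * gagliardo s G u := by
  have hC := one_le_hardyConst hL hsp
  set C := hardyConst s pm pp with hC_def
  have hC0 : 0 < C := by linarith
  have hpm : 0 < pm := by linarith [hL.1]
  have hφ : phiG pm pp C = C ^ (1 / pm) := by rw [phiG, if_pos hC]
  rw [hφ]
  set D := C ^ (1 / pm) with hD
  have hD0 : 0 < D := by positivity
  have hD1 : 1 ≤ D := Real.one_le_rpow hC (by positivity)
  have hDpm : D⁻¹ ^ pm = C⁻¹ := by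
    rw [Real.inv_rpow hD0.le, hD, ← Real.rpow_mul hC0.le, one_div_mul_cancel hpm.ne',
      Real.rpow_one]
  have hne : ENNReal.ofReal D ≠ 0 := by simpa using hD0
  rw [gagliardo, luxemburg]
  simp_rw [ENNReal.mul_iInf_of_ne hne ENNReal.ofReal_ne_top]
  refine le_iInf fun l => le_iInf fun hl => le_iInf fun hle => ?_
  rw [← ENNReal.ofReal_mul hD0.le]
  refine iInf_le_of_le (D * l) (iInf_le_of_le (by positivity) (iInf_le_of_le ?_ le_rfl))
  have hmem : MemW s G (fun x => u x / l) :=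
    ⟨hu.aemeasurable.div_const l, hG.modular_div_const_lt_top hL hu.modular_lt_top hl,
      hle.trans_lt ENNReal.one_lt_top⟩
  have h0 : HasValueAtZero (fun x => u x / l) 0 := by simpa using hu0.div_const l
  have hH := hG.modular_hardy hL hs hsp hmem h0
  calc modular G (fun x => u x / x ^ s / (D * l))
      ≤ ∫⁻ x in Ioi (0 : ℝ), ENNReal.ofReal C⁻¹ * ENNReal.ofReal (G (|u x / l| / x ^ s)) := by
        refine setLIntegral_mono' measurableSet_Ioi fun x hx => ?_
        have hx0 : (0 : ℝ) < x := hx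
        have hxs : 0 < x ^ s := by positivity
        rw [← ENNReal.ofReal_mul (by positivity), ← hDpm]
        refine ENNReal.ofReal_le_ofReal ?_
        have heq : |u x / x ^ s / (D * l)| = D⁻¹ * (|u x / l| / x ^ s) := by
          rw [abs_div, abs_div, abs_div, abs_of_pos hxs, abs_of_pos hl,
            abs_of_pos (mul_pos hD0 hl)]
          field_simp
        rw [heq]
        exact hG.map_mul_le_rpow_of_le_one hL (by positivity) (inv_le_one_of_one_le₀ hD1)
          (by positivity)
    _ = ENNReal.ofReal C⁻¹ * ∫⁻ x in Ioi (0 : ℝ), ENNReal.ofReal (G (|u x / l| / x ^ s)) :=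
        lintegral_const_mul' _ _ ENNReal.ofReal_ne_top
    _ ≤ ENNReal.ofReal C⁻¹ * (ENNReal.ofReal C * 1) := by
        gcongr
        exact hH.trans (by gcongr)
    _ = 1 := by
        rw [mul_one, ← ENNReal.ofReal_mul (by positivity), inv_mul_cancel₀ hC0.ne',
          ENNReal.ofReal_one]

end IsYoungFunction

end OrliczHardy

theorem mainTheorem4 (G g : ℝ → ℝ) (pm pp s : ℝ)
    (hG : OrliczHardy.IsYoungFunction G g)
    (hL : OrliczHardy.GrowthCondition G g pm pp)
    (hs0 : 0 < s) (hs1 : s < 1) (hsp : 1 < s * pm)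
    (u : ℝ → ℝ) (hu : OrliczHardy.MemW s G u) :
    -- `u` has a representative that is Hölder continuous near the origin,
    (∃ v : ℝ → ℝ, v =ᵐ[volume.restrict (Ioi 0)] u ∧
      ∃ δ C : ℝ, 0 < δ ∧ ∀ x ∈ Ico (0 : ℝ) δ, ∀ y ∈ Ico (0 : ℝ) δ,
        |v x - v y| ≤ C * |x - y| ^ (s - 1 / pm)) ∧
    -- so the value `u(0)` is well defined,
    (∃! a : ℝ, OrliczHardy.HasValueAtZero u a) ∧
    -- and if it is zero, the modular and the norm Hardy inequalities hold.
    (OrliczHardy.HasValueAtZero u 0 →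
      (∫⁻ x in Ioi (0 : ℝ), ENNReal.ofReal (G (|u x| / x ^ s)))
          ≤ ENNReal.ofReal (OrliczHardy.hardyConst s pm pp) * OrliczHardy.fracModular s G u ∧
      OrliczHardy.luxNorm G (fun x => u x / x ^ s)
          ≤ ENNReal.ofReal (OrliczHardy.phiG pm pp (OrliczHardy.hardyConst s pm pp)) *
            OrliczHardy.gagliardo s G u) := by
  obtain ⟨v, C, hv, hvu, hC⟩ := hG.exists_holder_representative hL hs0 hsp hu
  have hval : OrliczHardy.HasValueAtZero u (v 0) := ⟨v, hvu, ⟨1, one_pos, hv.continuousOn⟩, rfl⟩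
  refine ⟨⟨v, hvu, 1 / 2, C, by norm_num, fun x hx y hy => hC x y (abs_le.2 ⟨?_, ?_⟩)⟩,
    ⟨v 0, hval, fun a ha => ha.unique hval⟩,
    fun h0 => ⟨hG.modular_hardy hL hs0 hsp hu h0, hG.luxNorm_hardy hL hs0 hsp hu h0⟩⟩ <;>
  linarith [hx.1, hx.2, hy.1, hy.2]
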